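/- All graphs are finite, simple and undirected. For a graph $G$ with adjacency matrix $A$ and diagonal degree matrix $D$, its Laplacian spectrum (respectively, signless Laplacian spectrum) is the multiset of eigenvalues of $D-A$ (respectively, $D+A$), counted with multiplicity. A graph $G$ is called DLS (respectively, DQS) if every graph with the same Laplacian spectrum (respectively, signless Laplacian spectrum) as $G$ is isomorphic to $G$. Let $G\sqcup H$ denote the disjoint union of $G$ and $H$, let $rG$ denote the disjoint union of $r$ copies of $G$, and let $K_2$ be the complete graph on two vertices. Theorem. Let $T$ be a tree of order $n$ (that is, with $n$ vertices) that is DLS. Then $T\sqcup rK_2$ is DLS for every positive integer $r$. Moreover, if $n$ is odd and $r=1$, then $T\sqcup rK_2 = T\sqcup K_2$ is DQS. -/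

import Mathlib

universe u

noncomputable section

namespace SpectralGraph

/-- The signless Laplacian matrix `Q = D + A` of a graph. -/
def signlessLapMatrix {V : Type*} [Fintype V] [DecidableEq V] (G : SimpleGraph V)
    [DecidableRel G.Adj] : Matrix V V ℝ :=
  G.degMatrix ℝ + G.adjMatrix ℝ

open Classical in
/-- The Laplacian spectrum: the multiset of eigenvalues of `D - A`, with multiplicities. As the
matrix is real symmetric, all the roots of its characteristic polynomial are real. -/
def lapSpectrum {V : Type*} [Fintype V] (G : SimpleGraph V) : Multiset ℝ :=
  (G.lapMatrix ℝ).charpoly.roots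

open Classical in
/-- The signless Laplacian spectrum: the multiset of eigenvalues of `D + A`, with
multiplicities. -/
def signlessLapSpectrum {V : Type*} [Fintype V] (G : SimpleGraph V) : Multiset ℝ :=
  (signlessLapMatrix G).charpoly.roots

/-- `G` is determined by its Laplacian spectrum: every finite graph with the same Laplacian
spectrum is isomorphic to `G`. Every finite graph has an isomorphic copy in each universe, so
letting `W` range over the universe of `V` covers all finite graphs. -/
def IsDLS {V : Type u} [Fintype V] (G : SimpleGraph V) : Prop :=
  ∀ (W : Type u) [Fintype W] (H : SimpleGraph W),
    lapSpectrum H = lapSpectrum G → Nonempty (H ≃g G)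

/-- `G` is determined by its signless Laplacian spectrum. -/
def IsDQS {V : Type u} [Fintype V] (G : SimpleGraph V) : Prop :=
  ∀ (W : Type u) [Fintype W] (H : SimpleGraph W),
    signlessLapSpectrum H = signlessLapSpectrum G → Nonempty (H ≃g G)

/-- The disjoint union `rG` of `r` copies of the graph `G`. -/
def copies {V : Type*} (r : ℕ) (G : SimpleGraph V) : SimpleGraph (Fin r × V) where
  Adj p q := p.1 = q.1 ∧ G.Adj p.2 q.2
  symm := ⟨fun _ _ h => ⟨h.1.symm, h.2.symm⟩⟩
  loopless := ⟨fun _ h => G.irrefl h.2⟩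

end SpectralGraph

end

open Polynomial

namespace SpectralGraph

/-! Work with characteristic polynomials over `ℤ`; they are monic and split over `ℝ`, so they carry
the same information as the spectra. For a tree of order `n` the Laplacian polynomial is `X * ψ`
with `ψ 0 = ± n` (matrix-tree, `lapPoly_tree_eq`).

Let `H` have the Laplacian polynomial of `T ⊔ r K₂`, with `T` of order `n`. Degree and trace give `n
+ 2r` vertices and `n - 1 + r` edges. Every component contributes a factor `X`, so there are at most
`r + 1` of them, and the edge count then forces a forest with exactly `r + 1` trees. Their orders
have sum `n + 2r` and, by comparing constant terms after removing powers of `X`, product `2 ^ r *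
n`. A tree has the eigenvalue `2` at most once, and only if its order is even; hence at most one
order is odd. By `orders_of_sum_of_prod` the orders are `n, 2, ..., 2`, or else `n = 9` and they are
`6, 6, 1, 2, ..., 2`. Traces of `L ^ 2` and `L ^ 3` exclude the latter (`lapPoly_nine_ne_six_six`).
Cancelling the copies of `K₂` leaves a component cospectral to `T`, and `T` is DLS.

In the signless case with `r = 1` and `n` odd, the same counts give exactly two tree components, any
other having as many edges as vertices. Such a component has determinant divisible by `4`
(`four_dvd_lapPoly_coeff_zero`), whereas the constant term after removing `X ^ 2` is `± 2n`. So `H`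
is a forest, hence bipartite; its two spectra agree and the first part applies. -/

open Classical in
/-- The integer matrix `D + s • A`: the Laplacian matrix for `s = -1` and the signless Laplacian
matrix for `s = 1`. -/
noncomputable def signedLap {V : Type*} (s : ℤ) (G : SimpleGraph V) : Matrix V V ℤ :=
  Matrix.of fun i j => if i = j then ((G.neighborSet i).ncard : ℤ) else if G.Adj i j then s else 0

open Classical in
/-- The characteristic polynomial of `signedLap s G`. -/
noncomputable def lapPoly {V : Type*} [Finite V] (s : ℤ) (G : SimpleGraph V) : ℤ[X] :=
  letI := Fintype.ofFinite V
  (signedLap s G).charpoly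

/-! ### Characteristic polynomials of graphs: products, traces, real roots -/

section Basic

variable {V W : Type*}

lemma signedLap_apply_self (s : ℤ) (G : SimpleGraph V) (i : V) :
    signedLap s G i i = (G.neighborSet i).ncard := by
  simp [signedLap]

lemma signedLap_apply_of_adj (s : ℤ) {G : SimpleGraph V} {i j : V} (h : G.Adj i j) :
    signedLap s G i j = s := by
  simp [signedLap, h, h.ne]

lemma signedLap_apply_of_not_adj (s : ℤ) {G : SimpleGraph V} {i j : V} (hne : i ≠ j)
    (h : ¬ G.Adj i j) : signedLap s G i j = 0 := by
  simp [signedLap, h, hne]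

lemma signedLap_isSymm (s : ℤ) (G : SimpleGraph V) : (signedLap s G).IsSymm := by
  ext i j
  by_cases h : i = j
  · subst h; rfl
  · by_cases ha : G.Adj i j
    · simp [signedLap, h, Ne.symm h, ha, ha.symm]
    · simp [signedLap, h, Ne.symm h, ha, mt SimpleGraph.Adj.symm ha]

lemma lapPoly_eq [Fintype V] [DecidableEq V] (s : ℤ) (G : SimpleGraph V) :
    lapPoly s G = (signedLap s G).charpoly := by
  unfold lapPoly
  congr!

lemma lapPoly_monic [Finite V] (s : ℤ) (G : SimpleGraph V) : (lapPoly s G).Monic := by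
  classical
  have := Fintype.ofFinite V
  rw [lapPoly_eq]
  exact Matrix.charpoly_monic _

lemma natDegree_lapPoly [Finite V] (s : ℤ) (G : SimpleGraph V) :
    (lapPoly s G).natDegree = Nat.card V := by
  classical
  have := Fintype.ofFinite V
  rw [lapPoly_eq, Matrix.charpoly_natDegree_eq_dim, Nat.card_eq_fintype_card]

lemma ncard_neighborSet_iso {G : SimpleGraph V} {H : SimpleGraph W} (e : G ≃g H) (i : V) :
    (H.neighborSet (e i)).ncard = (G.neighborSet i).ncard := by
  rw [← Nat.card_coe_set_eq, ← Nat.card_coe_set_eq]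
  exact Nat.card_congr (e.mapNeighborSet i).symm

lemma lapPoly_iso [Finite V] [Finite W] (s : ℤ) {G : SimpleGraph V} {H : SimpleGraph W}
    (e : G ≃g H) : lapPoly s G = lapPoly s H := by
  classical
  have := Fintype.ofFinite V
  have := Fintype.ofFinite W
  rw [lapPoly_eq, lapPoly_eq, ← Matrix.charpoly_reindex e.toEquiv]
  congr 1
  ext i j
  obtain ⟨i, rfl⟩ := e.surjective i
  obtain ⟨j, rfl⟩ := e.surjective j
  have h : ∀ k, e.toEquiv.symm (e k) = k := fun k => e.toEquiv.symm_apply_apply k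
  have hadj : H.Adj (e i) (e j) ↔ G.Adj i j := e.map_adj_iff
  simp [signedLap, h, ncard_neighborSet_iso e, hadj]

lemma ncard_neighborSet_induce_fiber {ι : Type*} (G : SimpleGraph V) (f : V → ι)
    (hf : ∀ u v, G.Adj u v → f u = f v) (i : ι) (v : {v | f v = i}) :
    ((G.induce {v | f v = i}).neighborSet v).ncard = (G.neighborSet v).ncard := by
  rw [← Set.ncard_image_of_injective _ Subtype.val_injective]
  congr 1
  ext w
  simp only [Set.mem_image, SimpleGraph.mem_neighborSet, SimpleGraph.comap_adj,
    Function.Embedding.subtype_apply, Subtype.exists]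
  constructor
  · rintro ⟨a, ha, h, rfl⟩
    exact h
  · intro h
    exact ⟨w, (hf _ _ h).symm.trans v.2, h, rfl⟩

/-- The characteristic polynomial of a disjoint union is a product. -/
lemma lapPoly_eq_prod [Finite V] {ι : Type*} [Fintype ι] (s : ℤ) (G : SimpleGraph V) (f : V → ι)
    (hf : ∀ u v, G.Adj u v → f u = f v) :
    lapPoly s G = ∏ i, lapPoly s (G.induce {v | f v = i}) := by
  classical
  have := Fintype.ofFinite V
  -- An arbitrary order on the parts, so that a block diagonal matrix can be treated as block
  -- triangular.
  let _ : LinearOrder ι := LinearOrder.lift' (Fintype.equivFin ι) (Fintype.equivFin ι).injective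
  have hB : (signedLap s G).BlockTriangular f := by
    intro i j hij
    refine signedLap_apply_of_not_adj s ?_ fun h => hij.ne (hf _ _ h).symm
    rintro rfl
    exact hij.false
  rw [lapPoly_eq, Matrix.charpoly, hB.charmatrix.det_fintype]
  refine Finset.prod_congr rfl fun i _ => ?_
  rw [← Matrix.charmatrix_toSquareBlock, ← Matrix.charpoly]
  have : Fintype {v | f v = i} := Fintype.ofFinite _
  rw [lapPoly_eq]
  have : (signedLap s G).toSquareBlock f i = signedLap s (G.induce {v | f v = i}) := by
    ext u v
    have := ncard_neighborSet_induce_fiber G f hf i u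
    simp only [Matrix.toSquareBlock_def, signedLap, Matrix.of_apply, SimpleGraph.comap_adj,
      Function.Embedding.subtype_apply, Subtype.ext_iff]
    rw [← this]
  rw [this]
  congr!

lemma ncard_neighborSet_eq_degree (G : SimpleGraph V) (v : V) [Fintype (G.neighborSet v)] :
    (G.neighborSet v).ncard = G.degree v := by
  rw [← SimpleGraph.card_neighborSet_eq_degree, Set.ncard_eq_toFinset_card', Set.toFinset_card]

lemma sum_ncard_neighborSet [Fintype V] (G : SimpleGraph V) :
    ∑ v, (G.neighborSet v).ncard = 2 * Nat.card G.edgeSet := by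
  classical
  have h := G.sum_degrees_eq_twice_card_edges
  rw [SimpleGraph.edgeFinset_card, ← Nat.card_eq_fintype_card] at h
  rw [← h]
  exact Finset.sum_congr rfl fun v _ => ncard_neighborSet_eq_degree G v

lemma nextCoeff_lapPoly [Finite V] (s : ℤ) (G : SimpleGraph V) :
    (lapPoly s G).nextCoeff = -(2 * Nat.card G.edgeSet : ℤ) := by
  classical
  have := Fintype.ofFinite V
  rw [lapPoly_eq, ← neg_neg (nextCoeff _), ← Matrix.trace_eq_neg_charpoly_nextCoeff]
  have := sum_ncard_neighborSet G
  simp only [Matrix.trace, Matrix.diag_apply, signedLap_apply_self]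
  exact_mod_cast congrArg (fun n : ℕ => -(n : ℤ)) this

lemma isHermitian_signedLap (s : ℤ) (G : SimpleGraph V) :
    ((signedLap s G).map (Int.castRingHom ℝ)).IsHermitian := by
  have := signedLap_isSymm s G
  ext i j
  simp [← this.apply i j]

lemma map_lapPoly_eq [Fintype V] [DecidableEq V] (s : ℤ) (G : SimpleGraph V) :
    (lapPoly s G).map (Int.castRingHom ℝ) =
      ((signedLap s G).map (Int.castRingHom ℝ)).charpoly := by
  rw [lapPoly_eq, Matrix.charpoly_map]

lemma splits_lapPoly [Finite V] (s : ℤ) (G : SimpleGraph V) :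
    ((lapPoly s G).map (Int.castRingHom ℝ)).Splits := by
  classical
  have := Fintype.ofFinite V
  rw [map_lapPoly_eq]
  exact (isHermitian_signedLap s G).splits_charpoly

/-- Monic split polynomials are determined by their roots. This transfers cospectrality to `ℤ[X]`,
where divisibility arguments are available. -/
lemma lapPoly_eq_of_roots_eq [Finite V] [Finite W] {s t : ℤ} {G : SimpleGraph V}
    {H : SimpleGraph W} (h : ((lapPoly s G).map (Int.castRingHom ℝ)).roots =
      ((lapPoly t H).map (Int.castRingHom ℝ)).roots) : lapPoly s G = lapPoly t H := by
  refine Polynomial.map_injective _ (RingHom.injective_int (Int.castRingHom ℝ)) ?_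
  rw [(splits_lapPoly s G).eq_prod_roots_of_monic ((lapPoly_monic s G).map _),
    (splits_lapPoly t H).eq_prod_roots_of_monic ((lapPoly_monic t H).map _), h]

lemma lapSpectrum_eq [Fintype V] (G : SimpleGraph V) :
    lapSpectrum G = ((lapPoly (-1) G).map (Int.castRingHom ℝ)).roots := by
  classical
  rw [map_lapPoly_eq, lapSpectrum]
  congr 2
  ext i j
  by_cases hij : i = j
  · subst hij
    simp [signedLap_apply_self, SimpleGraph.lapMatrix, SimpleGraph.degMatrix,
      ncard_neighborSet_eq_degree]
  · by_cases ha : G.Adj i j <;>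
      simp [signedLap, SimpleGraph.lapMatrix, SimpleGraph.degMatrix, hij, ha]

lemma signlessLapSpectrum_eq [Fintype V] (G : SimpleGraph V) :
    signlessLapSpectrum G = ((lapPoly 1 G).map (Int.castRingHom ℝ)).roots := by
  classical
  rw [map_lapPoly_eq, signlessLapSpectrum]
  congr 2
  ext i j
  by_cases hij : i = j
  · subst hij
    simp [signedLap_apply_self, signlessLapMatrix, SimpleGraph.degMatrix,
      ncard_neighborSet_eq_degree]
  · by_cases ha : G.Adj i j <;>
      simp [signedLap, signlessLapMatrix, SimpleGraph.degMatrix, hij, ha]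

/-- Conjugating by the diagonal matrix of signs of the two colour classes negates `A` and fixes `D`.
-/
lemma lapPoly_one_eq_of_colorable [Finite V] {G : SimpleGraph V} (h : G.Colorable 2) :
    lapPoly 1 G = lapPoly (-1) G := by
  classical
  have := Fintype.ofFinite V
  obtain ⟨c⟩ := h
  set d : V → ℤ := fun v => if c v = 0 then 1 else -1 with hd
  have hd2 : ∀ v, d v * d v = 1 := fun v => by simp only [hd]; split_ifs <;> norm_num
  have hDD : Matrix.diagonal d * Matrix.diagonal d = 1 := by
    rw [Matrix.diagonal_mul_diagonal, ← Matrix.diagonal_one]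
    congr 1
    ext v
    exact hd2 v
  have hconj : signedLap 1 G = Matrix.diagonal d * (signedLap (-1) G * Matrix.diagonal d) := by
    ext i j
    rw [Matrix.diagonal_mul, Matrix.mul_diagonal]
    by_cases hij : i = j
    · subst hij
      rw [signedLap_apply_self, signedLap_apply_self, mul_comm, mul_assoc, hd2, mul_one]
    by_cases ha : G.Adj i j
    · rw [signedLap_apply_of_adj _ ha, signedLap_apply_of_adj _ ha]
      have := c.valid ha
      simp only [hd]
      split_ifs <;> first | norm_num; done | omega
    · simp [signedLap_apply_of_not_adj _ hij ha]
  rw [lapPoly_eq, lapPoly_eq, hconj, Matrix.charpoly_mul_comm, Matrix.mul_assoc, hDD,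
    Matrix.mul_one]


end Basic

/-! ### Trees: minors of the Laplacian and the eigenvalue 2 -/

section Tree

variable {V : Type*}

/-- In a tree with root `v`, every other vertex has a parent, and the edges are exactly the pairs
of a vertex and its parent. -/
lemma exists_parent [Finite V] {T : SimpleGraph V} (hT : T.IsTree) (v : V) :
    ∃ p : V → V, (∀ u, u ≠ v → T.dist v (p u) < T.dist v u) ∧
      ∀ a b, T.Adj a b ↔ (a ≠ v ∧ p a = b) ∨ (b ≠ v ∧ p b = a) := by
  classical
  have := Fintype.ofFinite V
  have hex : ∀ u, ∃ w, u ≠ v → T.Adj u w ∧ T.dist v w < T.dist v u := by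
    intro u
    by_cases hu : u = v
    · exact ⟨u, fun h => absurd hu h⟩
    obtain ⟨q, hq⟩ := hT.connected.exists_walk_length_eq_dist u v
    cases q with
    | nil => exact absurd rfl hu
    | cons h q =>
      refine ⟨_, fun _ => ⟨h, ?_⟩⟩
      rw [SimpleGraph.dist_comm, SimpleGraph.dist_comm (u := v)]
      have := SimpleGraph.dist_le q
      rw [SimpleGraph.Walk.length_cons] at hq
      omega
  choose p hp using hex
  refine ⟨p, fun u hu => (hp u hu).2, ?_⟩
  -- Distances to the root make this map injective; a tree has `n - 1` edges, so it is onto and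
  -- every edge joins a vertex to its parent.
  let F : {u // u ≠ v} → T.edgeSet := fun u => ⟨s(u.1, p u.1), (hp u.1 u.2).1⟩
  have hF : Function.Injective F := by
    rintro ⟨a, ha⟩ ⟨b, hb⟩ h
    have h' : s(a, p a) = s(b, p b) := congrArg Subtype.val h
    rw [Sym2.eq_iff] at h'
    rcases h' with h' | ⟨h1, h2⟩
    · exact Subtype.ext h'.1
    · have h3 := (hp a ha).2
      have h4 := (hp b hb).2
      rw [h2] at h3
      rw [← h1] at h4
      omega
  have hcard : Fintype.card {u // u ≠ v} = Fintype.card T.edgeSet := by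
    have h1 := hT.card_edgeFinset
    rw [SimpleGraph.edgeFinset_card] at h1
    rw [Fintype.card_subtype_compl, Fintype.card_subtype_eq]
    omega
  have hS : Function.Surjective F :=
    ((Fintype.bijective_iff_injective_and_card F).2 ⟨hF, hcard⟩).2
  intro a b
  constructor
  · intro hab
    obtain ⟨⟨u, hu⟩, h⟩ := hS ⟨s(a, b), hab⟩
    have h' : s(u, p u) = s(a, b) := congrArg Subtype.val h
    rw [Sym2.eq_iff] at h'
    rcases h' with ⟨rfl, h2⟩ | ⟨rfl, h2⟩
    · exact Or.inl ⟨hu, h2⟩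
    · exact Or.inr ⟨hu, h2⟩
  · rintro (⟨h, rfl⟩ | ⟨h, rfl⟩)
    · exact (hp a h).1
    · exact (hp b h).1.symm

open Classical in
/-- Every vertex-deleted principal minor of the Laplacian matrix of a tree is `1`. -/
lemma det_minor_tree [Fintype V] {T : SimpleGraph V} (hT : T.IsTree) (v : V) :
    ((signedLap (-1) T).submatrix (Subtype.val : {u // u ≠ v} → V) Subtype.val).det = 1 := by
  obtain ⟨p, hp, hadj⟩ := exists_parent hT v
  have hpne : ∀ u, u ≠ v → p u ≠ u := fun u hu h => by
    have := hp u hu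
    rw [h] at this
    exact this.false
  -- The oriented incidence matrix without the row of the root; column `u` is the edge from `u` to
  -- its parent. Ordered by distance to the root it is unitriangular, and `M * Mᵀ` is the minor.
  let M : Matrix {u // u ≠ v} {u // u ≠ v} ℤ :=
    Matrix.of fun w u => (if u = w then 1 else 0) - if p u.1 = w.1 then 1 else 0
  have hM : M.det = 1 := by
    have hB : M.BlockTriangular fun u => T.dist v u.1 := by
      intro i j hij
      have h1 : j ≠ i := by rintro rfl; exact hij.false
      have h2 : p j.1 ≠ i.1 := by
        intro h
        have := hp j.1 j.2
        rw [h] at this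
        exact this.asymm hij
      simp [M, h1, h2]
    rw [hB.det]
    refine Finset.prod_eq_one fun k _ => ?_
    have : M.toSquareBlock (fun u => T.dist v u.1) k = 1 := by
      ext i j
      have h2 : p j.1.1 ≠ i.1.1 := by
        intro h
        have := hp j.1.1 j.1.2
        rw [h] at this
        have h3 := i.2
        have h4 := j.2
        omega
      have h3 : i = j ↔ j = i := eq_comm
      simp [M, Matrix.toSquareBlock_def, h2, Matrix.one_apply, ← Subtype.ext_iff, h3]
    rw [this, Matrix.det_one]
  have hL : (signedLap (-1) T).submatrix (Subtype.val : {u // u ≠ v} → V) Subtype.val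
      = M * M.transpose := by
    ext i j
    rw [Matrix.mul_apply, Matrix.submatrix_apply]
    simp only [Matrix.transpose_apply]
    by_cases hij : i = j
    · subst hij
      have h1 : ∀ u : {u // u ≠ v}, M i u * M i u =
          (if u = i then 1 else 0) + if p u.1 = i.1 then 1 else 0 := by
        intro u
        by_cases hu : u = i
        · subst hu
          simp [M, hpne u.1 u.2]
        · by_cases hpu : p u.1 = i.1 <;> simp [M, hu, hpu]
      have h2 : T.neighborSet i.1 = insert (p i.1)
          (Subtype.val '' {u : {u // u ≠ v} | p u.1 = i.1}) := by
        ext w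
        have := i.2
        rw [SimpleGraph.mem_neighborSet, hadj, Set.mem_insert_iff]
        simp only [Set.mem_image, Set.mem_ofPred_eq, Subtype.exists, exists_and_right,
          exists_eq_right]
        simp only [this, ne_eq, not_false_eq_true, true_and, eq_comm (a := w), exists_prop]
      have h3 : p i.1 ∉ Subtype.val '' {u : {u // u ≠ v} | p u.1 = i.1} := by
        rintro ⟨u, hu, hui⟩
        have e1 := hp i.1 i.2
        have e2 := hp u.1 u.2
        rw [← hui] at e1
        rw [hu] at e2
        omega
      rw [signedLap_apply_self, h2, Set.ncard_insert_of_notMem h3,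
        Set.ncard_image_of_injective _ Subtype.val_injective, Finset.sum_congr rfl fun u _ => h1 u,
        Finset.sum_add_distrib, Finset.sum_ite_eq' _ i, Finset.sum_boole,
        Set.ncard_eq_toFinset_card']
      simp [add_comm]
    · have h1 : ∀ u : {u // u ≠ v}, M i u * M j u =
          -(if u = i then if p i.1 = j.1 then 1 else 0 else 0) -
            if u = j then if p j.1 = i.1 then 1 else 0 else 0 := by
        intro u
        by_cases hu : u = i
        · subst hu
          simp [M, hpne u.1 u.2, hij]
        · by_cases hu' : u = j
          · subst hu'
            simp [M, hpne u.1 u.2, hu]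
          · have : p u.1 = i.1 → p u.1 ≠ j.1 := fun h h' => hij (Subtype.ext (h.symm.trans h'))
            by_cases hpu : p u.1 = i.1 <;> simp_all [M]
      rw [Finset.sum_congr rfl fun u _ => h1 u, Finset.sum_sub_distrib, Finset.sum_neg_distrib,
        Finset.sum_ite_eq' _ i, Finset.sum_ite_eq' _ j]
      have hne : i.1 ≠ j.1 := fun h => hij (Subtype.ext h)
      have h2 : p i.1 = j.1 → p j.1 ≠ i.1 := by
        intro h h'
        have e1 := hp i.1 i.2
        have e2 := hp j.1 j.2
        rw [h] at e1
        rw [h'] at e2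
        omega
      have h3 := hadj i.1 j.1
      simp only [i.2, j.2, ne_eq, not_false_eq_true, true_and] at h3
      by_cases hpi : p i.1 = j.1
      · rw [signedLap_apply_of_adj _ (h3.2 (Or.inl hpi))]
        simp [hpi, h2 hpi]
      · by_cases hpj : p j.1 = i.1
        · rw [signedLap_apply_of_adj _ (h3.2 (Or.inr hpj))]
          simp [hpi, hpj]
        · rw [signedLap_apply_of_not_adj _ hne fun h => (h3.1 h).elim hpi hpj]
          simp [hpi, hpj]
  rw [hL, Matrix.det_mul, Matrix.det_transpose, hM, one_mul]

/-- The all-ones vector lies in the kernel of `D - A`. -/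
lemma lapPoly_coeff_zero [Finite V] [Nonempty V] (G : SimpleGraph V) :
    (lapPoly (-1) G).coeff 0 = 0 := by
  classical
  have := Fintype.ofFinite V
  have h : (signedLap (-1) G).det = 0 := by
    rw [← Matrix.exists_mulVec_eq_zero_iff]
    refine ⟨fun _ => 1, fun h => one_ne_zero (congrFun h (Classical.arbitrary V)), ?_⟩
    ext i
    have h1 : ∀ j, signedLap (-1) G i j =
        (if i = j then ((G.neighborSet i).ncard : ℤ) else 0) - if G.Adj i j then 1 else 0 := by
      intro j
      by_cases hij : i = j
      · subst hij; simp [signedLap]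
      · by_cases ha : G.Adj i j <;> simp [signedLap, hij, ha]
    simp only [Matrix.mulVec, dotProduct, mul_one, h1, Finset.sum_sub_distrib,
      Finset.sum_ite_eq, Finset.mem_univ, if_true, Finset.sum_boole, Pi.zero_apply]
    rw [Set.ncard_eq_toFinset_card', sub_eq_zero]
    congr 2
    ext
    simp
  rw [Matrix.det_eq_sign_charpoly_coeff, ← lapPoly_eq] at h
  exact (mul_eq_zero.1 h).resolve_left (pow_ne_zero _ (by norm_num))

/-- The matrix-tree theorem for trees. -/
lemma lapPoly_coeff_one_tree [Finite V] {T : SimpleGraph V} (hT : T.IsTree) :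
    (lapPoly (-1) T).coeff 1 = (-1) ^ (Nat.card V - 1) * Nat.card V := by
  classical
  have := Fintype.ofFinite V
  have := hT.connected.nonempty
  have hpos : 0 < Fintype.card V := Fintype.card_pos
  have h := Matrix.charpoly_coeff_eq_sum_minors (signedLap (-1) T) (Fintype.card V - 1)
    (Nat.sub_le _ _)
  rw [show Fintype.card V - (Fintype.card V - 1) = 1 by omega] at h
  rw [lapPoly_eq, h, Nat.card_eq_fintype_card]
  congr 1
  have h1 : ∀ s ∈ (Finset.univ : Finset V).powersetCard (Fintype.card V - 1),
      ((signedLap (-1) T).submatrix (Subtype.val : s → V) (Subtype.val : s → V)).det = 1 := by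
    intro s hs
    have hs' := (Finset.mem_powersetCard.1 hs).2
    have hc : sᶜ.card = 1 := by rw [Finset.card_compl, hs']; omega
    obtain ⟨v, hv⟩ := Finset.card_eq_one.1 hc
    have hmem : ∀ u, u ≠ v ↔ u ∈ s := by
      intro u
      rw [← Finset.notMem_compl, hv, Finset.mem_singleton]
    refine Eq.trans ?_ (det_minor_tree hT v)
    rw [← Matrix.det_submatrix_equiv_self (Equiv.subtypeEquivRight hmem)]
    congr!
  rw [Finset.sum_congr rfl h1, Finset.sum_const, Finset.card_powersetCard, Finset.card_univ,
    Nat.choose_symm hpos, Nat.choose_one_right, nsmul_eq_mul, mul_one]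

/-- The characteristic polynomial of a tree is `X * ψ` with `ψ 0 = ± n`. -/
lemma lapPoly_tree_eq [Finite V] {T : SimpleGraph V} (hT : T.IsTree) :
    ∃ ψ : ℤ[X], lapPoly (-1) T = X * ψ ∧ (ψ.coeff 0).natAbs = Nat.card V := by
  have := hT.connected.nonempty
  obtain ⟨ψ, hψ⟩ := X_dvd_iff.2 (lapPoly_coeff_zero T)
  refine ⟨ψ, hψ, ?_⟩
  have h := lapPoly_coeff_one_tree hT
  rw [hψ, coeff_X_mul] at h
  rw [h, Int.natAbs_mul, Int.natAbs_pow]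
  simp

/-- If `2` is a Laplacian eigenvalue of a tree, the order of the tree is even. -/
lemma even_card_of_isRoot_two [Finite V] {T : SimpleGraph V} (hT : T.IsTree)
    (h : (lapPoly (-1) T).IsRoot 2) : Even (Nat.card V) := by
  obtain ⟨ψ, hψ, hc⟩ := lapPoly_tree_eq hT
  rw [hψ, IsRoot, eval_mul, eval_X] at h
  have h2 : ψ.eval 2 = 0 := (mul_eq_zero.1 h).resolve_left (by norm_num)
  -- Since `ψ 2 = 0`, the integer `2 - 0` divides `ψ 0 = ± n`.
  have h3 := sub_dvd_eval_sub (2 : ℤ) 0 ψ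
  rw [h2, ← coeff_zero_eq_eval_zero] at h3
  rw [← hc, Int.natAbs_even]
  exact even_iff_two_dvd.2 (by simpa using h3)

-- Modulo `2` the shift by `2` disappears and the minor becomes that of the Laplacian, which is `1`.
open Classical in
lemma det_minor_sub_two_ne_zero [Fintype V] {T : SimpleGraph V} (hT : T.IsTree) (v : V) :
    ((signedLap (-1) T - Matrix.diagonal fun _ => (2 : ℤ)).submatrix
      (Subtype.val : {u // u ≠ v} → V) Subtype.val).det ≠ 0 := by
  intro h
  have h1 := congrArg (Int.castRingHom (ZMod 2)) (det_minor_tree hT v)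
  have h2 := congrArg (Int.castRingHom (ZMod 2)) h
  rw [RingHom.map_det] at h1 h2
  have h3 : (Int.castRingHom (ZMod 2)).mapMatrix ((signedLap (-1) T - Matrix.diagonal fun _ => (2 : ℤ)).submatrix
      (Subtype.val : {u // u ≠ v} → V) Subtype.val) = (Int.castRingHom (ZMod 2)).mapMatrix
      ((signedLap (-1) T).submatrix (Subtype.val : {u // u ≠ v} → V) Subtype.val) := by
    ext i j
    have : (2 : ZMod 2) = 0 := rfl
    by_cases hij : i = j
    · subst hij
      simp [this]
    · simp [← Subtype.ext_iff, hij]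
  rw [h3, h1] at h2
  simp at h2

/-- The Laplacian eigenvalue `2` of a tree is simple. -/
lemma rootMultiplicity_two_le_one [Finite V] {T : SimpleGraph V} (hT : T.IsTree) :
    (lapPoly (-1) T).rootMultiplicity 2 ≤ 1 := by
  classical
  have := Fintype.ofFinite V
  by_contra hlt
  have hA := isHermitian_signedLap (-1) T
  set A := (signedLap (-1) T).map (Int.castRingHom ℝ) with hAdef
  have hcount : 1 < A.charpoly.roots.count 2 := by
    rw [← map_lapPoly_eq, count_roots]
    have := eq_rootMultiplicity_map (p := lapPoly (-1) T)
      (RingHom.injective_int (Int.castRingHom ℝ)) 2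
    simp only [map_ofNat] at this
    omega
  rw [hA.roots_charpoly_eq_eigenvalues, Multiset.count_map, ← Finset.filter_val,
    Finset.card_val, Finset.one_lt_card] at hcount
  obtain ⟨i, hi, j, hj, hij⟩ := hcount
  simp only [Finset.mem_filter, Finset.mem_univ, true_and, Function.comp_apply] at hi hj
  have hei := hA.mulVec_eigenvectorBasis i
  have hej := hA.mulVec_eigenvectorBasis j
  have hon := hA.eigenvectorBasis.orthonormal
  obtain ⟨v⟩ := hT.connected.nonempty
  -- Two independent eigenvectors combine to a nonzero one vanishing at `v`; its restriction is then
  -- in the kernel of the nonsingular minor of `L - 2`.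
  obtain ⟨z, hz0, hzv, hz⟩ : ∃ z : EuclideanSpace ℝ V, z ≠ 0 ∧ z v = 0 ∧
      A.mulVec z = (2 : ℝ) • (z : V → ℝ) := by
    by_cases hxv : hA.eigenvectorBasis i v = 0
    · refine ⟨_, hon.ne_zero i, hxv, ?_⟩
      rw [hei]
      exact congrArg (· • _) hi.symm
    · refine ⟨hA.eigenvectorBasis j v • hA.eigenvectorBasis i -
        hA.eigenvectorBasis i v • hA.eigenvectorBasis j, ?_, ?_, ?_⟩
      · intro h
        have h1 := congrArg (inner ℝ (hA.eigenvectorBasis j)) h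
        rw [inner_sub_right, inner_smul_right, inner_smul_right, hon.2 hij.symm,
          real_inner_self_eq_norm_sq, hon.1 j] at h1
        simp [hxv] at h1
      · simp [mul_comm]
      · have hi' : hA.eigenvalues i = 2 := hi.symm
        have hj' : hA.eigenvalues j = 2 := hj.symm
        rw [hi'] at hei
        rw [hj'] at hej
        simp only [WithLp.ofLp_sub, WithLp.ofLp_smul, Matrix.mulVec_sub, Matrix.mulVec_smul,
          hei, hej, smul_sub]
        rw [smul_comm, smul_comm (2 : ℝ) (hA.eigenvectorBasis i v)]
  refine det_minor_sub_two_ne_zero hT v ?_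
  refine (RingHom.injective_int (Int.castRingHom ℝ)) ?_
  rw [RingHom.map_det, map_zero, ← Matrix.exists_mulVec_eq_zero_iff]
  refine ⟨fun u => z u.1, fun h => hz0 ?_, ?_⟩
  · ext u
    by_cases hu : u = v
    · rw [hu]; exact hzv
    · exact congrFun h ⟨u, hu⟩
  · ext u
    have hzu := congrFun hz u.1
    simp only [Matrix.mulVec, dotProduct, Pi.smul_apply, smul_eq_mul] at hzu ⊢
    rw [Fintype.sum_eq_add_sum_subtype_ne _ v, hzv, mul_zero, zero_add] at hzu
    have h1 : ∀ w : {w // w ≠ v}, (Int.castRingHom ℝ).mapMatrix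
        ((signedLap (-1) T - Matrix.diagonal fun _ => (2 : ℤ)).submatrix Subtype.val Subtype.val)
          u w * z w.1 = A u.1 w.1 * z w.1 - if u = w then 2 * z w.1 else 0 := by
      intro w
      by_cases huw : u = w
      · subst huw
        simp [hAdef, sub_mul]
      · simp [hAdef, huw, ← Subtype.ext_iff]
    rw [Finset.sum_congr rfl fun w _ => h1 w, Finset.sum_sub_distrib, hzu]
    simp

end Tree

/-! ### Power sums of eigenvalues and exclusion of the orders 6, 6, 1 -/

section PowerSums

/-- The `k`-th power sum of the real roots of an integer polynomial. -/
noncomputable def powerSum (k : ℕ) (p : ℤ[X]) : ℝ :=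
  ((p.map (Int.castRingHom ℝ)).roots.map (· ^ k)).sum

lemma powerSum_mul (k : ℕ) {p q : ℤ[X]} (hp : p.Monic) (hq : q.Monic) :
    powerSum k (p * q) = powerSum k p + powerSum k q := by
  rw [powerSum, Polynomial.map_mul, roots_mul, Multiset.map_add, Multiset.sum_add, powerSum,
    powerSum]
  exact mul_ne_zero (hp.map _).ne_zero (hq.map _).ne_zero

lemma powerSum_X_sub_C (k : ℕ) (a : ℤ) : powerSum k (X - C a) = (a : ℝ) ^ k := by
  rw [powerSum, Polynomial.map_sub, map_X, map_C, roots_X_sub_C, Multiset.map_singleton,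
    Multiset.sum_singleton, eq_intCast]

lemma trace_pow_eq_sum_roots {n : Type*} [Fintype n] [DecidableEq n] {A : Matrix n n ℝ}
    (hA : A.IsHermitian) (k : ℕ) :
    (A ^ k).trace = (A.charpoly.roots.map (· ^ k)).sum := by
  rw [hA.roots_charpoly_eq_eigenvalues, Multiset.map_map]
  conv_lhs => rw [hA.spectral_theorem]
  rw [← map_pow, Unitary.conjStarAlgAut_apply, Matrix.trace_mul_cycle,
    Unitary.coe_star_mul_self, one_mul, Matrix.diagonal_pow, Matrix.trace_diagonal]
  simp

variable {V : Type*}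

lemma powerSum_lapPoly [Fintype V] [DecidableEq V] (s : ℤ) (G : SimpleGraph V) (k : ℕ) :
    powerSum k (lapPoly s G) = ((signedLap s G ^ k).trace : ℤ) := by
  rw [powerSum, map_lapPoly_eq, ← trace_pow_eq_sum_roots (isHermitian_signedLap s G)]
  have : (signedLap s G).map (Int.castRingHom ℝ) ^ k =
      (Int.castRingHom ℝ).mapMatrix (signedLap s G ^ k) := by
    rw [map_pow]; rfl
  rw [this, RingHom.mapMatrix_apply]
  simp [Matrix.trace]

open Classical in
lemma signedLap_neg_one_eq [Fintype V] (G : SimpleGraph V) :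
    signedLap (-1) G = Matrix.diagonal (fun v => (G.degree v : ℤ)) - G.adjMatrix ℤ := by
  ext i j
  by_cases hij : i = j
  · subst hij; simp [signedLap_apply_self, ncard_neighborSet_eq_degree]
  · by_cases ha : G.Adj i j <;> simp [signedLap, hij, ha]

open Classical in
lemma trace_signedLap_sq [Fintype V] (G : SimpleGraph V) :
    (signedLap (-1) G ^ 2).trace = ∑ v, ((G.degree v : ℤ) ^ 2 + G.degree v) := by
  have h1 : ∀ v, (G.adjMatrix ℤ * G.adjMatrix ℤ) v v = G.degree v :=
    fun v => G.adjMatrix_mul_self_apply_self v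
  rw [signedLap_neg_one_eq, Matrix.trace]
  refine Finset.sum_congr rfl fun v _ => ?_
  rw [Matrix.diag_apply, pow_two, sub_mul, mul_sub, mul_sub]
  simp only [Matrix.sub_apply, h1, Matrix.diagonal_mul_diagonal, Matrix.diagonal_mul,
    Matrix.mul_diagonal, Matrix.diagonal_apply_eq]
  simp
  ring

-- Expand `(D - A) ^ 3`. Without triangles `A ^ 3` has zero diagonal, as have the terms with a
-- single `A`; the three terms with two `A`s each have trace `∑ d ^ 2`.
open Classical in
lemma trace_signedLap_cube [Fintype V] {G : SimpleGraph V} (hG : G.CliqueFree 3) :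
    (signedLap (-1) G ^ 3).trace = ∑ v, ((G.degree v : ℤ) ^ 3 + 3 * (G.degree v : ℤ) ^ 2) := by
  set A := G.adjMatrix ℤ with hA
  set D := Matrix.diagonal (fun v => (G.degree v : ℤ)) with hD
  have h1 : ∀ v, (A * A) v v = G.degree v := fun v => G.adjMatrix_mul_self_apply_self v
  have h3 : ∀ v, (A * A * A) v v = 0 := by
    intro v
    rw [Matrix.mul_apply]
    refine Finset.sum_eq_zero fun u _ => ?_
    rw [Matrix.mul_apply, Finset.sum_mul]
    refine Finset.sum_eq_zero fun w _ => ?_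
    simp only [hA, SimpleGraph.adjMatrix_apply]
    by_cases a : G.Adj v w
    · by_cases b : G.Adj w u
      · by_cases c : G.Adj u v
        · exact absurd (SimpleGraph.is3Clique_triple_iff.2 ⟨a, c.symm, b⟩) (hG _)
        · simp [c]
      · simp [b]
    · simp [a]
  have hexp : (D - A) ^ 3 = D * (D * D) - D * (D * A) - D * A * D + D * (A * A) - A * D * D
      + A * D * A + A * A * D - A * A * A := by noncomm_ring
  have hcyc : (A * D * A).trace = (D * (A * A)).trace := by
    rw [Matrix.trace_mul_cycle, Matrix.trace_mul_comm]
  rw [signedLap_neg_one_eq, hexp]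
  simp only [Matrix.trace_sub, Matrix.trace_add, hcyc]
  simp only [Matrix.trace, Matrix.diag_apply, h3, ← Finset.sum_sub_distrib,
    ← Finset.sum_add_distrib]
  refine Finset.sum_congr rfl fun v _ => ?_
  have h0 : A v v = 0 := by simp [hA]
  simp only [hD, Matrix.diagonal_mul, Matrix.mul_diagonal, Matrix.diagonal_apply_eq, h1, h0]
  ring

/-- Grouping by value makes power sums linear in the numbers of entries of each size, which suits
`omega`. -/
lemma sum_excess_eq {ι : Type*} [Fintype ι] (e : ι → ℕ) (m : ℕ) (he : ∀ v, e v < m)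
    (f : ℕ → ℕ) : ∑ v, f (e v) =
      ∑ j ∈ Finset.range m, (Finset.univ.filter fun v => e v = j).card * f j := by
  rw [← Finset.sum_fiberwise_of_maps_to (s := Finset.univ) (t := Finset.range m) (g := e)
    fun v _ => Finset.mem_range.2 (he v)]
  refine Finset.sum_congr rfl fun j _ => ?_
  rw [Finset.sum_congr rfl fun v hv => congrArg f (Finset.mem_filter.1 hv).2, Finset.sum_const,
    smul_eq_mul]

/-- The alternatives are the partitions `1+1+1+1`, `2+1+1`, `2+2`, `3+1` and `4`. -/
lemma sq_cube_sums_of_sum_eq_four {ι : Type*} [Fintype ι] (e : ι → ℕ) (h : ∑ v, e v = 4) :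
    (∑ v, e v ^ 2 = 4 ∧ ∑ v, e v ^ 3 = 4) ∨ (∑ v, e v ^ 2 = 6 ∧ ∑ v, e v ^ 3 = 10) ∨
    (∑ v, e v ^ 2 = 8 ∧ ∑ v, e v ^ 3 = 16) ∨ (∑ v, e v ^ 2 = 10 ∧ ∑ v, e v ^ 3 = 28) ∨
    (∑ v, e v ^ 2 = 16 ∧ ∑ v, e v ^ 3 = 64) := by
  have he : ∀ v, e v < 5 := fun v => by
    have := Finset.single_le_sum (f := e) (fun i _ => Nat.zero_le _) (Finset.mem_univ v)
    omega
  rw [sum_excess_eq e 5 he fun j => j] at h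
  rw [sum_excess_eq e 5 he fun j => j ^ 2, sum_excess_eq e 5 he fun j => j ^ 3]
  simp only [Finset.sum_range_succ, Finset.sum_range_zero] at h ⊢
  generalize (Finset.univ.filter fun v => e v = 0).card = c0 at *
  generalize (Finset.univ.filter fun v => e v = 1).card = c1 at *
  generalize (Finset.univ.filter fun v => e v = 2).card = c2 at *
  generalize (Finset.univ.filter fun v => e v = 3).card = c3 at *
  generalize (Finset.univ.filter fun v => e v = 4).card = c4 at *
  have h4 : c4 ≤ 1 := by omega
  have h3 : c3 ≤ 1 := by omega
  have h2 : c2 ≤ 2 := by omega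
  interval_cases c4 <;> interval_cases c3 <;> interval_cases c2 <;> omega

/-- The degree sequences of a tree of order `9` plus two edges and of two trees of order `6` plus
an isolated vertex differ in one of their first three power sums. -/
lemma excess_sums_ne {ι κ μ : Type*} [Fintype ι] [Fintype κ] [Fintype μ] (e : ι → ℕ) (a : κ → ℕ)
    (b : μ → ℕ) (he : ∑ v, e v = 7) (ha : ∑ v, a v = 4) (hb : ∑ v, b v = 4)
    (h2 : ∑ v, e v ^ 2 = ∑ v, a v ^ 2 + ∑ v, b v ^ 2 + 1)
    (h3 : ∑ v, e v ^ 3 + 1 = ∑ v, a v ^ 3 + ∑ v, b v ^ 3) : False := by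
  have he' : ∀ v, e v < 8 := fun v => by
    have := Finset.single_le_sum (f := e) (fun i _ => Nat.zero_le _) (Finset.mem_univ v)
    omega
  rw [sum_excess_eq e 8 he' fun j => j] at he
  rw [sum_excess_eq e 8 he' fun j => j ^ 2] at h2
  rw [sum_excess_eq e 8 he' fun j => j ^ 3] at h3
  simp only [Finset.sum_range_succ, Finset.sum_range_zero] at he h2 h3
  generalize (Finset.univ.filter fun v => e v = 0).card = c0 at *
  generalize (Finset.univ.filter fun v => e v = 1).card = c1 at *
  generalize (Finset.univ.filter fun v => e v = 2).card = c2 at *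
  generalize (Finset.univ.filter fun v => e v = 3).card = c3 at *
  generalize (Finset.univ.filter fun v => e v = 4).card = c4 at *
  generalize (Finset.univ.filter fun v => e v = 5).card = c5 at *
  generalize (Finset.univ.filter fun v => e v = 6).card = c6 at *
  generalize (Finset.univ.filter fun v => e v = 7).card = c7 at *
  have h4' : c4 ≤ 1 := by omega
  have h5' : c5 ≤ 1 := by omega
  have h6' : c6 ≤ 1 := by omega
  have h7' : c7 ≤ 1 := by omega
  rcases sq_cube_sums_of_sum_eq_four a ha with ⟨h, h'⟩ | ⟨h, h'⟩ | ⟨h, h'⟩ | ⟨h, h'⟩ | ⟨h, h'⟩ <;>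
  rcases sq_cube_sums_of_sum_eq_four b hb with ⟨k, k'⟩ | ⟨k, k'⟩ | ⟨k, k'⟩ | ⟨k, k'⟩ | ⟨k, k'⟩ <;>
  rw [h, k] at h2 <;> rw [h', k'] at h3 <;>
  interval_cases c4 <;> interval_cases c5 <;> interval_cases c6 <;> interval_cases c7 <;> omega

/-- The second and third Laplacian power sums of a nontrivial tree in terms of the excesses
`degree v - 1`. -/
lemma exists_excess [Finite V] {T : SimpleGraph V} (hT : T.IsTree) (h2 : 2 ≤ Nat.card V) :
    ∃ e : Fin (Nat.card V) → ℕ, ∑ v, e v + 2 = Nat.card V ∧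
      powerSum 2 (lapPoly (-1) T) =
        ((∑ v, e v ^ 2 + 3 * ∑ v, e v + 2 * Nat.card V : ℕ) : ℝ) ∧
      powerSum 3 (lapPoly (-1) T) =
        ((∑ v, e v ^ 3 + 6 * ∑ v, e v ^ 2 + 9 * ∑ v, e v + 4 * Nat.card V : ℕ) : ℝ) := by
  classical
  have := Fintype.ofFinite V
  have hdeg : ∀ v, ∃ k, T.degree v = k + 1 := by
    intro v
    have : Nontrivial V := Finite.one_lt_card_iff_nontrivial.1 h2
    have := hT.connected.preconnected.degree_pos_of_nontrivial v
    exact ⟨T.degree v - 1, by omega⟩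
  choose e he using hdeg
  let φ : Fin (Nat.card V) ≃ V := (Finite.equivFin V).symm
  refine ⟨fun i => e (φ i), ?_⟩
  rw [φ.sum_comp e, φ.sum_comp fun v => e v ^ 2, φ.sum_comp fun v => e v ^ 3,
    powerSum_lapPoly, powerSum_lapPoly, trace_signedLap_sq,
    trace_signedLap_cube (hT.isAcyclic.cliqueFree le_rfl), Nat.card_eq_fintype_card]
  have hc : Fintype.card V = ∑ _v : V, 1 := by simp
  refine ⟨?_, ?_, ?_⟩
  · have h1 := T.sum_degrees_eq_twice_card_edges
    have h3 := hT.card_edgeFinset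
    simp only [he, Finset.sum_add_distrib] at h1
    rw [← hc] at h1
    omega
  · rw [hc, Finset.mul_sum, Finset.mul_sum, ← Finset.sum_add_distrib, ← Finset.sum_add_distrib]
    push_cast [he]
    exact Finset.sum_congr rfl fun v _ => by ring
  · rw [hc, Finset.mul_sum, Finset.mul_sum, Finset.mul_sum, ← Finset.sum_add_distrib,
      ← Finset.sum_add_distrib, ← Finset.sum_add_distrib]
    push_cast [he]
    exact Finset.sum_congr rfl fun v _ => by ring

/-- A tree of order `9` plus two edges is never cospectral to two trees of order `6` plus an
isolated vertex. -/
lemma lapPoly_nine_ne_six_six {W W' : Type*} [Finite V] [Finite W] [Finite W']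
    {T : SimpleGraph V} {A : SimpleGraph W} {B : SimpleGraph W'} (hT : T.IsTree) (hA : A.IsTree)
    (hB : B.IsTree) (hV : Nat.card V = 9) (hW : Nat.card W = 6) (hW' : Nat.card W' = 6) :
    lapPoly (-1) T * (X * (X - C 2)) ^ 2 ≠ lapPoly (-1) A * lapPoly (-1) B * X := by
  intro h
  obtain ⟨e, he1, he2, he3⟩ := exists_excess hT (by omega)
  obtain ⟨a, ha1, ha2, ha3⟩ := exists_excess hA (by omega)
  obtain ⟨b, hb1, hb2, hb3⟩ := exists_excess hB (by omega)
  -- The exponent is positive, so zero eigenvalues drop out and each `K₂` contributes `2 ^ (k + 1)`.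
  have key : ∀ k, powerSum (k + 1) (lapPoly (-1) T) + 2 * 2 ^ (k + 1) =
      powerSum (k + 1) (lapPoly (-1) A) + powerSum (k + 1) (lapPoly (-1) B) := by
    intro k
    have h1 := congrArg (powerSum (k + 1)) h
    have hX : powerSum (k + 1) X = 0 := by
      have := powerSum_X_sub_C (k + 1) 0
      simpa using this
    have hK : (X * (X - C 2) : ℤ[X]).Monic := monic_X.mul (monic_X_sub_C 2)
    rw [pow_two, powerSum_mul _ (lapPoly_monic _ _) (hK.mul hK), powerSum_mul _ hK hK,
      powerSum_mul _ monic_X (monic_X_sub_C 2), powerSum_X_sub_C,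
      powerSum_mul _ ((lapPoly_monic _ _).mul (lapPoly_monic _ _)) monic_X,
      powerSum_mul _ (lapPoly_monic _ _) (lapPoly_monic _ _), hX] at h1
    push_cast at h1
    linarith
  have k2 := key 1
  have k3 := key 2
  norm_num only at k2 k3
  rw [he2, ha2, hb2] at k2
  rw [he3, ha3, hb3] at k3
  norm_cast at k2 k3
  -- The excesses of a tree sum to its order minus `2`, here `7`, `4` and `4`.
  exact excess_sums_ne e a b (by omega) (by omega) (by omega) (by omega) (by omega)

end PowerSums

/-! ### Graphs with as many edges as vertices -/

section SquareIncidence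

variable {V : Type*}

/-- If a nonempty graph has as many edges as vertices, then the determinant of its signless
Laplacian matrix, a square of an even number, is divisible by `4`. -/
lemma four_dvd_lapPoly_coeff_zero [Finite V] [Nonempty V] {G : SimpleGraph V}
    (h : Nat.card G.edgeSet = Nat.card V) : 4 ∣ (lapPoly 1 G).coeff 0 := by
  classical
  have := Fintype.ofFinite V
  -- Indexing edges by vertices makes the incidence matrix square. Its columns sum to `2`, so its
  -- determinant is even.
  let e : V ≃ G.edgeSet := (Fintype.equivOfCardEq (by simpa [Nat.card_eq_fintype_card] using h.symm))
  let B : Matrix V V ℤ := Matrix.of fun v w => G.incMatrix ℤ v (e w).1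
  have hB : signedLap 1 G = B * B.transpose := by
    ext i j
    have h1 := congrFun (congrFun (G.incMatrix_mul_transpose (R := ℤ)) i) j
    have h2 : (B * B.transpose) i j = (G.incMatrix ℤ * (G.incMatrix ℤ).transpose) i j := by
      rw [Matrix.mul_apply, Matrix.mul_apply]
      simp only [Matrix.transpose_apply, B, Matrix.of_apply]
      rw [e.sum_comp fun a : G.edgeSet => G.incMatrix ℤ i a.1 * G.incMatrix ℤ j a.1,
        ← Finset.sum_subtype G.edgeFinset (fun a => SimpleGraph.mem_edgeFinset)
          fun a => G.incMatrix ℤ i a * G.incMatrix ℤ j a]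
      refine Finset.sum_subset (Finset.subset_univ _) fun a _ ha => ?_
      rw [G.incMatrix_of_notMem_incidenceSet fun h => ha (SimpleGraph.mem_edgeFinset.2 h.1),
        zero_mul]
    rw [h2, h1]
    by_cases hij : i = j
    · subst hij
      simp [signedLap_apply_self, ncard_neighborSet_eq_degree]
    · by_cases ha : G.Adj i j <;> simp [signedLap, hij, ha]
  have hdet : (2 : ℤ) ∣ B.det := by
    refine (ZMod.intCast_zmod_eq_zero_iff_dvd B.det 2).1 ?_
    have h1 : ((Int.castRingHom (ZMod 2)).mapMatrix B).det = 0 := by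
      rw [← Matrix.exists_vecMul_eq_zero_iff]
      refine ⟨fun _ => 1, fun h => one_ne_zero (congrFun h (Classical.arbitrary V)), ?_⟩
      ext w
      have h2 := congrArg (Int.cast : ℤ → ZMod 2)
        (G.sum_incMatrix_apply_of_mem_edgeSet (R := ℤ) (e w).2)
      have h3 : (2 : ZMod 2) = 0 := rfl
      push_cast at h2
      simp only [Matrix.vecMul, dotProduct, one_mul, Pi.zero_apply, RingHom.mapMatrix_apply,
        Matrix.map_apply, B, Matrix.of_apply, eq_intCast]
      rw [h2, h3]
    rw [← RingHom.map_det] at h1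
    exact h1
  rw [lapPoly_eq]
  have h4 := Matrix.det_eq_sign_charpoly_coeff (signedLap 1 G)
  rw [hB, Matrix.det_mul, Matrix.det_transpose, ← hB] at h4
  have h5 : (4 : ℤ) ∣ B.det * B.det := mul_dvd_mul hdet hdet
  rw [h4] at h5
  rcases neg_one_pow_eq_or ℤ (Fintype.card V) with h6 | h6
  · rwa [h6, one_mul] at h5
  · rwa [h6, neg_one_mul, dvd_neg] at h5

end SquareIncidence

/-! ### Orders with prescribed sum and product -/

section Arithmetic

lemma sum_add_one_le_prod_add_one {ι : Type*} (s : Finset ι) (x : ι → ℕ) :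
    ∑ i ∈ s, x i + 1 ≤ ∏ i ∈ s, (x i + 1) := by
  classical
  induction s using Finset.induction_on with
  | empty => simp
  | insert a s ha ih =>
    rw [Finset.sum_insert ha, Finset.prod_insert ha]
    nlinarith [Nat.zero_le (x a * ∑ i ∈ s, x i)]

lemma prod_add_one_eq_one {ι : Type*} {s : Finset ι} {x : ι → ℕ} (h : ∀ i ∈ s, x i = 0) :
    ∏ i ∈ s, (x i + 1) = 1 :=
  Finset.prod_eq_one fun i hi => by rw [h i hi, zero_add]

/-- Here `m` is the one order that may be odd and the others are `2 * (x i + 1)`. The product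
outgrows the sum: one nonzero `x i` forces `m = 2`, two force `m = 1`, and then parity and size
leave only `2, 2`. -/
lemma orders_of_excess {ι : Type*} [DecidableEq ι] (s : Finset ι) (x : ι → ℕ) (m : ℕ)
    (hm : 0 < m) (h : m + 2 * ∑ i ∈ s, x i = m * ∏ i ∈ s, (x i + 1)) :
    (∀ i ∈ s, x i = 0) ∨ (m = 2 ∧ ∃ a ∈ s, ∀ i ∈ s, i ≠ a → x i = 0) ∨
      (m = 1 ∧ ∃ a ∈ s, ∃ b ∈ s, a ≠ b ∧ x a = 2 ∧ x b = 2 ∧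
        ∀ i ∈ s, i ≠ a → i ≠ b → x i = 0) := by
  by_cases h0 : ∀ i ∈ s, x i = 0
  · exact Or.inl h0
  push Not at h0
  obtain ⟨a, ha, hxa⟩ := h0
  right
  by_cases h1 : ∀ i ∈ s, i ≠ a → x i = 0
  · refine Or.inl ⟨?_, a, ha, h1⟩
    rw [← Finset.add_sum_erase s x ha, ← Finset.mul_prod_erase s _ ha,
      Finset.sum_eq_zero fun i hi => h1 i (Finset.mem_of_mem_erase hi) (Finset.ne_of_mem_erase hi),
      prod_add_one_eq_one fun i hi =>
        h1 i (Finset.mem_of_mem_erase hi) (Finset.ne_of_mem_erase hi)] at h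
    have h' : 2 * x a = m * x a := by linarith
    exact (Nat.eq_of_mul_eq_mul_right (Nat.pos_of_ne_zero hxa) h').symm
  push Not at h1
  obtain ⟨b, hb, hba, hxb⟩ := h1
  right
  have hb' : b ∈ s.erase a := Finset.mem_erase.2 ⟨hba, hb⟩
  rw [← Finset.add_sum_erase s x ha, ← Finset.mul_prod_erase s _ ha,
    ← Finset.add_sum_erase _ x hb', ← Finset.mul_prod_erase _ _ hb'] at h
  have hle := sum_add_one_le_prod_add_one ((s.erase a).erase b) x
  have hz : ∑ i ∈ (s.erase a).erase b, x i = 0 →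
      ∀ i ∈ s, i ≠ a → i ≠ b → x i = 0 := fun hs i hi hia hib =>
    Finset.sum_eq_zero_iff.1 hs i (Finset.mem_erase.2 ⟨hib, Finset.mem_erase.2 ⟨hia, hi⟩⟩)
  have hP : ∑ i ∈ (s.erase a).erase b, x i = 0 → ∏ i ∈ (s.erase a).erase b, (x i + 1) = 1 :=
    fun hs => prod_add_one_eq_one (Finset.sum_eq_zero_iff.1 hs)
  generalize ∑ i ∈ (s.erase a).erase b, x i = S at *
  generalize ∏ i ∈ (s.erase a).erase b, (x i + 1) = P at *
  generalize hu : x a = u at *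
  generalize hv : x b = v at *
  have hu1 : 1 ≤ u := Nat.pos_of_ne_zero hxa
  have hv1 : 1 ≤ v := Nat.pos_of_ne_zero hxb
  have huv : 1 ≤ u * v := Nat.mul_pos hu1 hv1
  have hbig : (u + 1) * ((v + 1) * (S + 1)) ≤ (u + 1) * ((v + 1) * P) := by gcongr
  have hm1 : m = 1 := by
    by_contra hne
    have hm2 : 2 ≤ m := by omega
    obtain ⟨Q, hQ⟩ : ∃ Q, (u + 1) * ((v + 1) * P) = Q + 1 := by
      have hP0 : 0 < P := by omega
      exact Nat.exists_eq_succ_of_ne_zero (by positivity)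
    rw [hQ] at h hbig
    have h2 : 2 * Q ≤ m * Q := by gcongr
    nlinarith [Nat.zero_le (u * S), Nat.zero_le (v * S), Nat.zero_le (u * v * S)]
  subst hm1
  -- With `m = 1` the product is `1 + 2 * (u + v + S)`, so `u` and `v` are even and at least `2`;
  -- growth then forces equality.
  have hodd : Odd ((u + 1) * ((v + 1) * P)) := ⟨u + (v + S), by linarith⟩
  rw [Nat.odd_mul, Nat.odd_mul] at hodd
  obtain ⟨ho1, ho2, -⟩ := hodd
  have hu2 : 2 ≤ u := by
    obtain ⟨k, hk⟩ := ho1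
    omega
  have hv2 : 2 ≤ v := by
    obtain ⟨k, hk⟩ := ho2
    omega
  obtain ⟨u', rfl⟩ := Nat.exists_eq_add_of_le hu2
  obtain ⟨v', rfl⟩ := Nat.exists_eq_add_of_le hv2
  have hS : S = 0 := by
    nlinarith [Nat.zero_le (u' * S), Nat.zero_le (v' * S), Nat.zero_le (u' * v' * S),
      Nat.zero_le (u' * v')]
  rw [hP hS, hS] at h
  have hu0 : u' = 0 := by nlinarith [Nat.zero_le (u' * v')]
  have hv0 : v' = 0 := by nlinarith [Nat.zero_le (u' * v')]
  subst hu0 hv0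
  exact ⟨rfl, a, ha, b, hb, hba.symm, hu, hv, hz hS⟩

/-- If positive integers with the sum and the product of `N, 2, ..., 2` are all even but at most
one, then they are `N, 2, ..., 2` or `6, 6, 1, 2, ..., 2`. -/
lemma orders_of_sum_of_prod {ι : Type*} [Fintype ι] [DecidableEq ι] (n : ι → ℕ) (N r : ℕ)
    (hcard : Fintype.card ι = r + 1) (hpos : ∀ i, 0 < n i) (hsum : ∑ i, n i = N + 2 * r)
    (hprod : ∏ i, n i = N * 2 ^ r) (i₀ : ι) (heven : ∀ i, i ≠ i₀ → Even (n i)) :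
    (∃ c, n c = N ∧ ∀ i, i ≠ c → n i = 2) ∨
      (N = 9 ∧ ∃ a b c, a ≠ b ∧ a ≠ c ∧ b ≠ c ∧ n a = 6 ∧ n b = 6 ∧ n c = 1 ∧
        ∀ i, i ≠ a → i ≠ b → i ≠ c → n i = 2) := by
  have hx : ∀ i, ∃ k, i ≠ i₀ → n i = 2 * (k + 1) := by
    intro i
    by_cases hi : i = i₀
    · exact ⟨0, fun h => absurd hi h⟩
    obtain ⟨k, hk⟩ := heven i hi
    have := hpos i
    exact ⟨k - 1, fun _ => by omega⟩
  choose x hx using hx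
  set s := Finset.univ.erase i₀ with hs
  have hmem : ∀ i, i ∈ s ↔ i ≠ i₀ := fun i => by simp [hs]
  have hsc : s.card = r := by
    rw [hs, Finset.card_erase_of_mem (Finset.mem_univ _), Finset.card_univ, hcard]
    rfl
  rw [← Finset.add_sum_erase _ n (Finset.mem_univ i₀), ← hs,
    Finset.sum_congr rfl fun i hi => hx i ((hmem i).1 hi), ← Finset.mul_sum,
    Finset.sum_add_distrib, Finset.sum_const, smul_eq_mul, mul_one, hsc] at hsum
  rw [← Finset.mul_prod_erase _ n (Finset.mem_univ i₀), ← hs,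
    Finset.prod_congr rfl fun i hi => hx i ((hmem i).1 hi), Finset.prod_mul_distrib,
    Finset.prod_const, hsc] at hprod
  have hN : n i₀ * ∏ i ∈ s, (x i + 1) = N :=
    Nat.eq_of_mul_eq_mul_right (pow_pos two_pos r) (by rw [← hprod]; ring)
  rcases orders_of_excess s x (n i₀) (hpos i₀) (by rw [hN]; omega) with
    h | ⟨hm, a, ha, h⟩ | ⟨hm, a, ha, b, hb, hab, hxa, hxb, h⟩
  · rw [prod_add_one_eq_one h, mul_one] at hN
    exact Or.inl ⟨i₀, hN, fun i hi => by rw [hx i hi, h i ((hmem i).2 hi)]⟩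
  -- Here `i₀` itself has order `2`, and `a` takes the order `N`.
  · refine Or.inl ⟨a, ?_, fun i hi => ?_⟩
    · rw [hm, ← Finset.mul_prod_erase _ _ ha, prod_add_one_eq_one fun i hi =>
        h i (Finset.mem_of_mem_erase hi) (Finset.ne_of_mem_erase hi), mul_one] at hN
      rw [hx a ((hmem a).1 ha), hN]
    · by_cases hi0 : i = i₀
      · rw [hi0, hm]
      · rw [hx i hi0, h i ((hmem i).2 hi0) hi]
  · refine Or.inr ⟨?_, a, b, i₀, hab, (hmem a).1 ha, (hmem b).1 hb, ?_, ?_, hm, ?_⟩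
    · have hb' : b ∈ s.erase a := Finset.mem_erase.2 ⟨hab.symm, hb⟩
      rw [hm, ← Finset.mul_prod_erase _ _ ha, ← Finset.mul_prod_erase _ _ hb',
        prod_add_one_eq_one fun i hi => h i (Finset.mem_of_mem_erase (Finset.mem_of_mem_erase hi))
          (Finset.ne_of_mem_erase (Finset.mem_of_mem_erase hi)) (Finset.ne_of_mem_erase hi),
        hxa, hxb] at hN
      exact hN.symm
    · rw [hx a ((hmem a).1 ha), hxa]
    · rw [hx b ((hmem b).1 hb), hxb]
    · intro i hia hib hi0
      rw [hx i hi0, h i ((hmem i).2 hi0) hia hib]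

end Arithmetic

/-! ### Disjoint unions and copies of `K₂` -/

section Fibers

variable {V W : Type*}

/-- Isomorphisms between the parts of two disjoint unions can be glued. -/
lemma nonempty_iso_of_fibers {ι : Type*} {G : SimpleGraph V} {H : SimpleGraph W} {f : V → ι}
    {g : W → ι} (hf : ∀ u v, G.Adj u v → f u = f v) (hg : ∀ u v, H.Adj u v → g u = g v)
    (e : ∀ i, Nonempty (G.induce {v | f v = i} ≃g H.induce {w | g w = i})) :
    Nonempty (G ≃g H) := by
  replace e := fun i => (e i).some
  let E : V ≃ W := Equiv.ofFiberEquiv (f := f) (g := g) fun i => (e i).toEquiv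
  have hE : ∀ i a (ha : f a = i), E a = (e i ⟨a, ha⟩).1 := by
    rintro i a rfl
    rfl
  have hgE : ∀ a, g (E a) = f a := fun a => by
    rw [hE _ a rfl]
    exact (e (f a) ⟨a, rfl⟩).2
  refine ⟨⟨E, ?_⟩⟩
  intro a b
  have key : ∀ h : f b = f a, H.Adj (E a) (E b) ↔ G.Adj a b := by
    intro h
    rw [hE _ a rfl, hE (f a) b h]
    exact (e (f a)).map_adj_iff (v := ⟨a, rfl⟩) (w := ⟨b, h⟩)
  constructor
  · intro h
    have h1 := hg _ _ h
    rw [hgE, hgE] at h1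
    exact (key h1.symm).1 h
  · intro h
    exact (key (hf _ _ h).symm).2 h

lemma nonempty_iso_completeGraph_two [Finite V] {G : SimpleGraph V} (hG : G.Connected)
    (h : Nat.card V = 2) : Nonempty (G ≃g SimpleGraph.completeGraph (Fin 2)) := by
  classical
  have := Fintype.ofFinite V
  have hnt : Nontrivial V := Finite.one_lt_card_iff_nontrivial.1 (by omega)
  have hadj : ∀ u v, G.Adj u v ↔ u ≠ v := by
    intro u v
    refine ⟨fun h => h.ne, fun huv => ?_⟩
    have hd := hG.preconnected.degree_pos_of_nontrivial u
    rw [SimpleGraph.degree_pos_iff_exists_adj] at hd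
    obtain ⟨w, hw⟩ := hd
    by_cases hwv : w = v
    · exact hwv ▸ hw
    have hc : ({u, v, w} : Finset V).card = 3 :=
      Finset.card_eq_three.2 ⟨u, v, w, huv, hw.ne, Ne.symm hwv, rfl⟩
    have := Finset.card_le_univ ({u, v, w} : Finset V)
    rw [hc, ← Nat.card_eq_fintype_card, h] at this
    omega
  refine ⟨⟨Finite.equivFinOfCardEq h, ?_⟩⟩
  intro a b
  rw [hadj]
  simp [SimpleGraph.completeGraph]

lemma lapPoly_completeGraph_two :
    lapPoly (-1) (SimpleGraph.completeGraph (Fin 2)) = X * (X - C 2) := by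
  have h : ∀ i : Fin 2, ((SimpleGraph.completeGraph (Fin 2)).neighborSet i).ncard = 1 := by
    intro i
    rw [ncard_neighborSet_eq_degree]
    simp
  have h2 : signedLap (-1) (SimpleGraph.completeGraph (Fin 2)) = !![1, -1; -1, 1] := by
    ext i j
    by_cases hij : i = j
    · subst hij
      rw [signedLap_apply_self, h]
      fin_cases i <;> rfl
    · rw [signedLap_apply_of_adj _ (G := SimpleGraph.completeGraph (Fin 2)) hij]
      fin_cases i <;> fin_cases j <;> first | rfl | exact absurd rfl hij
  rw [lapPoly_eq, h2, Matrix.charpoly_fin_two]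
  simp [Matrix.trace_fin_two, Matrix.det_fin_two]
  ring

lemma lapPoly_of_connected_of_card_eq_two [Finite V] {G : SimpleGraph V} (hG : G.Connected)
    (h : Nat.card V = 2) : lapPoly (-1) G = X * (X - C 2) := by
  obtain ⟨e⟩ := nonempty_iso_completeGraph_two hG h
  rw [lapPoly_iso (-1) e, lapPoly_completeGraph_two]

/-- The index of the part of a disjoint union `T ⊔ r G` to which a vertex belongs. -/
def part (V W : Type*) (r : ℕ) : V ⊕ (Fin r × W) → Option (Fin r) :=
  Sum.elim (fun _ => none) fun p => some p.1

lemma part_eq_of_adj (T : SimpleGraph V) (G : SimpleGraph W) (r : ℕ) (u v : V ⊕ (Fin r × W))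
    (h : (T.sum (copies r G)).Adj u v) : part V W r u = part V W r v := by
  rcases u with u | u <;> rcases v with v | v
  · rfl
  · simp at h
  · simp at h
  · have h' : (copies r G).Adj u v := by simpa using h
    exact congrArg some h'.1

lemma nonempty_iso_part_none (T : SimpleGraph V) (G : SimpleGraph W) (r : ℕ) :
    Nonempty (T ≃g (T.sum (copies r G)).induce {v | part V W r v = none}) := by
  let e : V ≃ {v | part V W r v = none} :=
    Equiv.ofBijective (fun v => ⟨Sum.inl v, rfl⟩) ⟨fun a b h => Sum.inl_injective (congrArg Subtype.val h), by
      rintro ⟨v | v, hv⟩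
      · exact ⟨v, rfl⟩
      · exact absurd hv (by simp [part])⟩
  refine ⟨⟨e, ?_⟩⟩
  intro a b
  exact Iff.rfl

lemma nonempty_iso_part_some (T : SimpleGraph V) (G : SimpleGraph W) (r : ℕ) (i : Fin r) :
    Nonempty (G ≃g (T.sum (copies r G)).induce {v | part V W r v = some i}) := by
  let e : W ≃ {v | part V W r v = some i} :=
    Equiv.ofBijective (fun w => ⟨Sum.inr (i, w), rfl⟩) ⟨fun a b h =>
      congrArg Prod.snd (Sum.inr_injective (congrArg Subtype.val h)), by
      rintro ⟨v | ⟨j, w⟩, hv⟩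
      · exact absurd hv (by simp [part])
      · obtain rfl : j = i := by simpa [part] using hv
        exact ⟨w, rfl⟩⟩
  refine ⟨⟨e, ?_⟩⟩
  intro a b
  exact ⟨fun h => h.2, fun h => ⟨rfl, h⟩⟩

lemma lapPoly_sum_copies [Finite V] [Finite W] (s : ℤ) (T : SimpleGraph V) (G : SimpleGraph W)
    (r : ℕ) : lapPoly s (T.sum (copies r G)) = lapPoly s T * lapPoly s G ^ r := by
  rw [lapPoly_eq_prod s _ (part V W r) (part_eq_of_adj T G r), Fintype.prod_option,
    ← lapPoly_iso s (nonempty_iso_part_none T G r).some,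
    Finset.prod_congr rfl fun i _ => (lapPoly_iso s (nonempty_iso_part_some T G r i).some).symm,
    Finset.prod_const, Finset.card_univ, Fintype.card_fin]

end Fibers

/-! ### Connected components -/

section Components

variable {V W : Type*}

/-- The component of `H` named `c`, as a graph on its own vertex set. -/
def componentGraph (H : SimpleGraph W) (c : H.ConnectedComponent) :
    SimpleGraph {v | H.connectedComponentMk v = c} :=
  H.induce {v | H.connectedComponentMk v = c}

lemma connected_componentGraph (H : SimpleGraph W) (c : H.ConnectedComponent) :
    (componentGraph H c).Connected :=
  c.connected_toSimpleGraph

lemma connectedComponentMk_eq_of_adj (H : SimpleGraph W) (u v : W) (h : H.Adj u v) :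
    H.connectedComponentMk u = H.connectedComponentMk v :=
  SimpleGraph.ConnectedComponent.sound h.reachable

lemma card_component_le (H : SimpleGraph W) (c : H.ConnectedComponent) :
    Nat.card {v | H.connectedComponentMk v = c} ≤ Nat.card (componentGraph H c).edgeSet + 1 :=
  (connected_componentGraph H c).card_vert_le_card_edgeSet_add_one

lemma isTree_componentGraph [Finite W] (H : SimpleGraph W) {c : H.ConnectedComponent}
    (h : Nat.card (componentGraph H c).edgeSet + 1 =
      Nat.card {v | H.connectedComponentMk v = c}) : (componentGraph H c).IsTree :=
  SimpleGraph.isTree_iff_connected_and_card.2 ⟨connected_componentGraph H c, h⟩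

variable [Finite W] (H : SimpleGraph W) [Fintype H.ConnectedComponent]

lemma lapPoly_eq_prod_components (s : ℤ) :
    lapPoly s H = ∏ c, lapPoly s (componentGraph H c) :=
  lapPoly_eq_prod s H _ (connectedComponentMk_eq_of_adj H)

lemma sum_card_components :
    ∑ c : H.ConnectedComponent, Nat.card {v | H.connectedComponentMk v = c} = Nat.card W := by
  rw [← natDegree_lapPoly 1 H, lapPoly_eq_prod_components,
    natDegree_prod_of_monic _ _ fun c _ => lapPoly_monic _ _]
  exact Finset.sum_congr rfl fun c _ => (natDegree_lapPoly _ _).symm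

/-- Compare second-highest coefficients in the product formula; the order count compares degrees.
The sign `s = 1` is immaterial. -/
lemma sum_card_edgeSet_components :
    ∑ c, Nat.card (componentGraph H c).edgeSet = Nat.card H.edgeSet := by
  have h := nextCoeff_lapPoly 1 H
  rw [lapPoly_eq_prod_components, Monic.nextCoeff_prod _ _ fun c _ => lapPoly_monic _ _,
    Finset.sum_congr rfl fun c _ => nextCoeff_lapPoly _ _, Finset.sum_neg_distrib,
    ← Finset.mul_sum] at h
  have h' : ((∑ c, Nat.card (componentGraph H c).edgeSet : ℕ) : ℤ) = Nat.card H.edgeSet := by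
    push_cast
    linarith
  exact_mod_cast h'

end Components

/-! ### Cospectral graphs are forests -/

section Spectra

variable {V W : Type*} [Finite V] [Finite W] {T : SimpleGraph V} {H : SimpleGraph W}

lemma le_of_X_pow_dvd {a b : ℕ} {q : ℤ[X]} (hq : q.coeff 0 ≠ 0)
    (h : X ^ a ∣ X ^ b * q) : a ≤ b := by
  by_contra hlt
  have := X_pow_dvd_iff.1 h b (not_le.1 hlt)
  rw [coeff_X_pow_mul', if_pos le_rfl, Nat.sub_self] at this
  exact hq this

/-- The polynomial of `T ⊔ r K₂` as a power of `X` times a polynomial with constant coefficient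
`± 2 ^ r n`. -/
lemma tree_mul_pow_eq (hT : T.IsTree) (r : ℕ) :
    ∃ q : ℤ[X], lapPoly (-1) T * (X * (X - C 2)) ^ r = X ^ (r + 1) * q ∧
      (q.coeff 0).natAbs = Nat.card V * 2 ^ r := by
  obtain ⟨ψ, hψ, hc⟩ := lapPoly_tree_eq hT
  refine ⟨ψ * (X - C 2) ^ r, by rw [hψ, mul_pow, pow_succ]; ring, ?_⟩
  rw [mul_coeff_zero, Int.natAbs_mul, hc, coeff_zero_eq_eval_zero]
  simp [Int.natAbs_pow]

lemma coeff_zero_ne_zero_of_natAbs [Nonempty V] {q : ℤ[X]} {r : ℕ}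
    (h : (q.coeff 0).natAbs = Nat.card V * 2 ^ r) : q.coeff 0 ≠ 0 := by
  rw [← Int.natAbs_ne_zero, h]
  have := Nat.card_pos (α := V)
  positivity

/-- The degree gives the order and the trace gives the size, for either sign `s`. -/
lemma cards_of_lapPoly_eq {s : ℤ} (hT : T.IsTree) {r : ℕ}
    (h : lapPoly s H = lapPoly (-1) T * (X * (X - C 2)) ^ r) :
    Nat.card W = Nat.card V + 2 * r ∧ Nat.card H.edgeSet + 1 = Nat.card V + r := by
  have hK : (X * (X - C 2) : ℤ[X]).Monic := monic_X.mul (monic_X_sub_C 2)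
  have hcard := (SimpleGraph.isTree_iff_connected_and_card.1 hT).2
  constructor
  · rw [← natDegree_lapPoly s H, h, (lapPoly_monic _ _).natDegree_mul (hK.pow r),
      natDegree_lapPoly, hK.natDegree_pow, monic_X.natDegree_mul (monic_X_sub_C 2),
      natDegree_X, natDegree_X_sub_C, mul_comm]
  · have h1 := nextCoeff_lapPoly s H
    have hX : (X : ℤ[X]).nextCoeff = 0 := by
      have := nextCoeff_X_sub_C (0 : ℤ)
      simpa using this
    rw [h, (lapPoly_monic _ _).nextCoeff_mul (hK.pow r), nextCoeff_lapPoly, hK.nextCoeff_pow,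
      monic_X.nextCoeff_mul (monic_X_sub_C 2), hX, nextCoeff_X_sub_C] at h1
    simp only [zero_add, nsmul_eq_mul] at h1
    have : ((Nat.card T.edgeSet : ℕ) : ℤ) + r = Nat.card H.edgeSet := by linarith
    omega

/-- A graph with the Laplacian spectrum of `T ⊔ r K₂` is a forest with `r + 1` components. -/
lemma components_isTree_of_lapPoly_eq (hT : T.IsTree) {r : ℕ}
    (h : lapPoly (-1) H = lapPoly (-1) T * (X * (X - C 2)) ^ r) :
    ∀ c, (componentGraph H c).IsTree := by
  have := Fintype.ofFinite H.ConnectedComponent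
  have := hT.connected.nonempty
  obtain ⟨q, hq, hq0⟩ := tree_mul_pow_eq hT r
  obtain ⟨hW, hE⟩ := cards_of_lapPoly_eq hT h
  have hle : Fintype.card H.ConnectedComponent ≤ r + 1 := by
    refine le_of_X_pow_dvd (coeff_zero_ne_zero_of_natAbs hq0) ?_
    rw [← hq, ← h, lapPoly_eq_prod_components, ← Finset.card_univ, ← Finset.prod_const]
    refine Finset.prod_dvd_prod_of_dvd _ _ fun c _ => ?_
    have := (connected_componentGraph H c).nonempty
    exact X_dvd_iff.2 (lapPoly_coeff_zero _)
  have h1 := sum_card_components H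
  have h2 := sum_card_edgeSet_components H
  -- Each component has at most one more vertex than edges; equality of the sums makes every one a
  -- tree.
  have h3 : ∑ c : H.ConnectedComponent, Nat.card {v | H.connectedComponentMk v = c} =
      ∑ c, (Nat.card (componentGraph H c).edgeSet + 1) := by
    refine le_antisymm (Finset.sum_le_sum fun c _ => card_component_le H c) ?_
    rw [Finset.sum_add_distrib, h1, h2, Finset.sum_const, Finset.card_univ, smul_eq_mul]
    omega
  intro c
  refine isTree_componentGraph H ?_
  exact ((Finset.sum_eq_sum_iff_of_le fun c _ => card_component_le H c).1 h3 c
    (Finset.mem_univ c)).symm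

/-- A graph with the signless Laplacian spectrum of `T ⊔ K₂`, where `T` has odd order, is a
forest. -/
lemma components_isTree_of_lapPoly_one_eq (hT : T.IsTree) (hodd : Odd (Nat.card V))
    (h : lapPoly 1 H = lapPoly (-1) T * (X * (X - C 2)) ^ 1) :
    ∀ c, (componentGraph H c).IsTree := by
  classical
  have := Fintype.ofFinite H.ConnectedComponent
  have := hT.connected.nonempty
  obtain ⟨q, hq, hq0⟩ := tree_mul_pow_eq hT 1
  obtain ⟨hW, hE⟩ := cards_of_lapPoly_eq hT h
  set n : H.ConnectedComponent → ℕ := fun c => Nat.card {v | H.connectedComponentMk v = c}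
  set m : H.ConnectedComponent → ℕ := fun c => Nat.card (componentGraph H c).edgeSet
  set S := Finset.univ.filter fun c => m c + 1 = n c with hS
  have hψ : ∀ c, ∃ ψ : ℤ[X], c ∈ S → lapPoly 1 (componentGraph H c) = X * ψ := by
    intro c
    by_cases hc : c ∈ S
    · have ht := isTree_componentGraph H (Finset.mem_filter.1 hc).2
      obtain ⟨ψ, hψ, -⟩ := lapPoly_tree_eq ht
      exact ⟨ψ, fun _ => by rw [lapPoly_one_eq_of_colorable ht.colorable_two, hψ]⟩
    · exact ⟨0, fun h => absurd h hc⟩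
  choose ψ hψ using hψ
  have hprod : X ^ (1 + 1) * q = X ^ S.card * (∏ c ∈ S, ψ c) *
      ∏ c ∈ Sᶜ, lapPoly 1 (componentGraph H c) := by
    rw [← hq, ← h, lapPoly_eq_prod_components, ← Finset.prod_mul_prod_compl S,
      Finset.prod_congr rfl fun c hc => hψ c hc, Finset.prod_mul_distrib, Finset.prod_const]
  have hSle : S.card ≤ 1 + 1 := by
    refine le_of_X_pow_dvd (coeff_zero_ne_zero_of_natAbs hq0) ?_
    rw [hprod, mul_assoc]
    exact dvd_mul_right _ _
  -- Only tree components have more vertices than edges. The totals differ by `2` and `S` has at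
  -- most two members, so all these bounds are equalities.
  have hnm : ∀ c, n c ≤ m c + if c ∈ S then 1 else 0 := by
    intro c
    have h1 : n c ≤ m c + 1 := card_component_le H c
    by_cases hc : c ∈ S
    · rwa [if_pos hc]
    · have : m c + 1 ≠ n c := fun h => hc (Finset.mem_filter.2 ⟨Finset.mem_univ _, h⟩)
      rw [if_neg hc]
      omega
  have h1 : ∑ c, n c = Nat.card W := sum_card_components H
  have h2 : ∑ c, m c = Nat.card H.edgeSet := sum_card_edgeSet_components H
  have h3 : ∑ c, (m c + if c ∈ S then 1 else 0) = Nat.card H.edgeSet + S.card := by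
    rw [Finset.sum_add_distrib, h2]
    simp
  have h4 : ∑ c, n c ≤ ∑ c, (m c + if c ∈ S then 1 else 0) :=
    Finset.sum_le_sum fun c _ => hnm c
  have hScard : S.card = 1 + 1 := by omega
  have h5 : ∑ c, n c = ∑ c, (m c + if c ∈ S then 1 else 0) := by omega
  intro c
  by_cases hc : c ∈ S
  · exact isTree_componentGraph H (Finset.mem_filter.1 hc).2
  exfalso
  have hnc : n c = m c := by
    have := (Finset.sum_eq_sum_iff_of_le fun c _ => hnm c).1 h5 c (Finset.mem_univ c)
    rwa [if_neg hc] at this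
  have := (connected_componentGraph H c).nonempty
  have h6 : 4 ∣ (lapPoly 1 (componentGraph H c)).coeff 0 :=
    four_dvd_lapPoly_coeff_zero hnc.symm
  rw [hScard, mul_assoc] at hprod
  have hq' := mul_left_cancel₀ (pow_ne_zero _ X_ne_zero) hprod
  have h7 : (4 : ℤ) ∣ q.coeff 0 := by
    rw [hq', mul_coeff_zero, ← Finset.mul_prod_erase _ _ (Finset.mem_compl.2 hc), mul_coeff_zero]
    exact dvd_mul_of_dvd_right (dvd_mul_of_dvd_left h6 _) _
  -- This would make `4` divide `2 * n` with `n` odd.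
  have h8 := Int.natAbs_dvd_natAbs.2 h7
  rw [hq0] at h8
  obtain ⟨k, hk⟩ := hodd
  rw [hk] at h8
  change 4 ∣ _ at h8
  omega

end Spectra

/-! ### Component orders and reconstruction of the graph -/

section Determined

lemma rootMultiplicity_finset_prod {ι : Type*} (s : Finset ι) (f : ι → ℤ[X])
    (h : ∀ i ∈ s, (f i).Monic) (a : ℤ) :
    (∏ i ∈ s, f i).rootMultiplicity a = ∑ i ∈ s, (f i).rootMultiplicity a := by
  classical
  induction s using Finset.induction_on with
  | empty => simp
  | insert i s hi ih =>
    have h1 : (∏ i ∈ s, f i).Monic :=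
      monic_prod_of_monic _ _ fun j hj => h j (Finset.mem_insert_of_mem hj)
    rw [Finset.prod_insert hi, Finset.sum_insert hi, rootMultiplicity_mul
      (mul_ne_zero (h i (Finset.mem_insert_self _ _)).ne_zero h1.ne_zero),
      ih fun j hj => h j (Finset.mem_insert_of_mem hj)]

lemma lapPoly_of_card_eq_one {W : Type*} [Finite W] {G : SimpleGraph W} (h : Nat.card W = 1) :
    lapPoly (-1) G = X := by
  have : Nonempty W := (Nat.card_pos_iff.1 (by omega)).1
  rw [(lapPoly_monic (-1) G).eq_X_add_C (by rw [natDegree_lapPoly, h]), lapPoly_coeff_zero,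
    C_0, add_zero]

/-- The orders of the components of a forest with the Laplacian spectrum of `T ⊔ r K₂`. -/
lemma component_orders {V W : Type*} [Finite V] [Finite W] {T : SimpleGraph V}
    {H : SimpleGraph W} [Fintype H.ConnectedComponent] (hT : T.IsTree) {r : ℕ}
    (h : lapPoly (-1) H = lapPoly (-1) T * (X * (X - C 2)) ^ r) :
    Fintype.card H.ConnectedComponent = r + 1 ∧
      ∃ c, Nat.card {v | H.connectedComponentMk v = c} = Nat.card V ∧
        ∀ i, i ≠ c → Nat.card {v | H.connectedComponentMk v = i} = 2 := by
  classical
  have htree := components_isTree_of_lapPoly_eq hT h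
  have := hT.connected.nonempty
  obtain ⟨hW, hE⟩ := cards_of_lapPoly_eq hT h
  set n : H.ConnectedComponent → ℕ := fun c => Nat.card {v | H.connectedComponentMk v = c} with hn
  have hsum : ∑ c, n c = Nat.card V + 2 * r := (sum_card_components H).trans hW
  have hcard : Fintype.card H.ConnectedComponent = r + 1 := by
    have h1 := sum_card_edgeSet_components H
    have h2 : ∑ c, n c = ∑ c, (Nat.card (componentGraph H c).edgeSet + 1) :=
      Finset.sum_congr rfl fun c _ =>
        (SimpleGraph.isTree_iff_connected_and_card.1 (htree c)).2.symm
    rw [Finset.sum_add_distrib, h1, Finset.sum_const, Finset.card_univ, smul_eq_mul] at h2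
    omega
  refine ⟨hcard, ?_⟩
  have hpos : ∀ c, 0 < n c := fun c => by
    have := (htree c).connected.nonempty
    exact Nat.card_pos
  choose ψ hψ hψ0 using fun c => lapPoly_tree_eq (htree c)
  have hprodH := lapPoly_eq_prod_components H (-1)
  have hprod : ∏ c, n c = Nat.card V * 2 ^ r := by
    obtain ⟨q, hq, hq0⟩ := tree_mul_pow_eq hT r
    rw [← hq0]
    have h1 : X ^ (r + 1) * q = X ^ (r + 1) * ∏ c, ψ c := by
      rw [← hq, ← h, hprodH, Finset.prod_congr rfl fun c _ => hψ c, Finset.prod_mul_distrib,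
        Finset.prod_const, Finset.card_univ, hcard]
    rw [mul_left_cancel₀ (pow_ne_zero _ X_ne_zero) h1, coeff_zero_prod]
    change _ = Int.natAbsHom _
    rw [map_prod]
    exact Finset.prod_congr rfl fun c _ => (hψ0 c).symm
  set E := Finset.univ.filter fun c => Even (n c) with hEdef
  -- The root `2` has multiplicity at least `r`, while each even component supplies at most one and
  -- odd components none.
  have hEr : r ≤ E.card := by
    have hK : (X * (X - C 2) : ℤ[X]).Monic := monic_X.mul (monic_X_sub_C 2)
    have h1 : r ≤ (lapPoly (-1) H).rootMultiplicity 2 := by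
      rw [le_rootMultiplicity_iff (lapPoly_monic _ _).ne_zero, h, mul_pow]
      exact dvd_mul_of_dvd_right (dvd_mul_left _ _) _
    rw [hprodH, rootMultiplicity_finset_prod _ _ fun c _ => lapPoly_monic _ _] at h1
    calc r ≤ _ := h1
      _ ≤ ∑ c, if Even (n c) then 1 else 0 := Finset.sum_le_sum fun c _ => by
        split_ifs with hc
        · exact rootMultiplicity_two_le_one (htree c)
        · refine (rootMultiplicity_eq_zero fun hroot => hc ?_).le
          exact even_card_of_isRoot_two (htree c) hroot
      _ = E.card := by rw [Finset.card_filter]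
  obtain ⟨i₀, hi₀⟩ : ∃ i₀, ∀ i, i ≠ i₀ → Even (n i) := by
    have hc : Eᶜ.card ≤ 1 := by
      rw [Finset.card_compl, hcard]
      omega
    have : Nonempty H.ConnectedComponent := Fintype.card_pos_iff.1 (by omega)
    rcases Finset.card_le_one_iff_subset_singleton (s := Eᶜ) |>.1 hc with ⟨i₀, hi⟩
    refine ⟨i₀, fun i hne => ?_⟩
    by_contra hev
    have : i ∈ Eᶜ := by
      rw [Finset.mem_compl, hEdef, Finset.mem_filter]
      exact fun h => hev h.2
    exact hne (Finset.mem_singleton.1 (hi this))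
  rcases orders_of_sum_of_prod n (Nat.card V) r hcard hpos hsum hprod i₀ hi₀ with
    hc | ⟨hV, a, b, c, hab, hac, hbc, ha, hb, hc, hrest⟩
  · exact hc
  exfalso
  have h1 : b ∈ Finset.univ.erase a := by simp [hab.symm]
  have h2 : c ∈ (Finset.univ.erase a).erase b := by simp [hac.symm, hbc.symm]
  have h3 : (((Finset.univ.erase a).erase b).erase c).card + 2 = r := by
    have e1 := Finset.card_erase_add_one (Finset.mem_univ a)
    have e2 := Finset.card_erase_add_one h1
    have e3 := Finset.card_erase_add_one h2
    rw [Finset.card_univ, hcard] at e1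
    omega
  rw [h, ← Finset.mul_prod_erase _ _ (Finset.mem_univ a), ← Finset.mul_prod_erase _ _ h1,
    ← Finset.mul_prod_erase _ _ h2, lapPoly_of_card_eq_one hc,
    Finset.prod_congr rfl fun i hi => lapPoly_of_connected_of_card_eq_two (htree i).connected
      (hrest i (by simp at hi; tauto) (by simp at hi; tauto) (by simp at hi; tauto)),
    Finset.prod_const, ← h3, pow_add] at hprodH
  have hK : (X * (X - C 2) : ℤ[X]) ≠ 0 := (monic_X.mul (monic_X_sub_C 2)).ne_zero
  exact lapPoly_nine_ne_six_six hT (htree a) (htree b) hV ha hb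
    (mul_right_cancel₀ (pow_ne_zero _ hK) (by linear_combination hprodH))

/-- A tree determined by its Laplacian spectrum stays so, after adding disjoint edges, in terms of
characteristic polynomials. -/
lemma nonempty_iso_of_lapPoly_eq {V W : Type u} [Fintype V] [Fintype W] {T : SimpleGraph V}
    {H : SimpleGraph W} (hT : T.IsTree) (hDLS : IsDLS T) {r : ℕ}
    (h : lapPoly (-1) H = lapPoly (-1) T * (X * (X - C 2)) ^ r) :
    Nonempty (H ≃g T.sum (copies r (SimpleGraph.completeGraph (Fin 2)))) := by
  classical
  have := Fintype.ofFinite H.ConnectedComponent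
  obtain ⟨hcard, c₀, -, hc⟩ := component_orders hT h
  have hconn := connected_componentGraph H
  have hK : (X * (X - C 2) : ℤ[X]) ≠ 0 := (monic_X.mul (monic_X_sub_C 2)).ne_zero
  have hpoly : lapPoly (-1) (componentGraph H c₀) = lapPoly (-1) T := by
    rw [lapPoly_eq_prod_components, ← Finset.mul_prod_erase _ _ (Finset.mem_univ c₀),
      Finset.prod_congr rfl fun i hi => lapPoly_of_connected_of_card_eq_two (hconn i)
        (hc i (Finset.ne_of_mem_erase hi)), Finset.prod_const,
      Finset.card_erase_of_mem (Finset.mem_univ c₀), Finset.card_univ, hcard] at h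
    exact mul_right_cancel₀ (pow_ne_zero _ hK) h
  have := Fintype.ofFinite {v | H.connectedComponentMk v = c₀}
  have hiso : Nonempty (componentGraph H c₀ ≃g T) :=
    hDLS _ _ (by rw [lapSpectrum_eq, lapSpectrum_eq, hpoly])
  have hsub : Fintype.card {c // c ≠ c₀} = Fintype.card (Fin r) := by
    rw [Fintype.card_subtype_compl, Fintype.card_subtype_eq, hcard, Fintype.card_fin]
    rfl
  -- Match `c₀` with the part `T` and the remaining components with the copies of `K₂`.
  let ε : H.ConnectedComponent ≃ Option (Fin r) :=
    (Equiv.optionSubtypeNe c₀).symm.trans (Equiv.optionCongr (Fintype.equivOfCardEq hsub))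
  have hε : ∀ c, ε c = none ↔ c = c₀ := fun c => by
    have h0 : ε c₀ = none := by simp [ε]
    rw [← h0, ε.apply_eq_iff_eq]
  refine nonempty_iso_of_fibers (connectedComponentMk_eq_of_adj H)
    (g := fun w => ε.symm (part V (Fin 2) r w)) (fun u v huv =>
      congrArg ε.symm (part_eq_of_adj T _ r u v huv)) fun c => ?_
  have hset : {w | ε.symm (part V (Fin 2) r w) = c} = {w | part V (Fin 2) r w = ε c} := by
    ext w
    exact ε.symm_apply_eq
  rw [hset]
  by_cases hcc : c = c₀
  · subst hcc
    rw [(hε c).2 rfl]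
    exact ⟨hiso.some.trans (nonempty_iso_part_none T _ r).some⟩
  · obtain ⟨i, hi⟩ := Option.ne_none_iff_exists'.1 fun hn => hcc ((hε c).1 hn)
    rw [hi]
    exact ⟨(nonempty_iso_completeGraph_two (hconn c) (hc c hcc)).some.trans
      (nonempty_iso_part_some T _ r i).some⟩

end Determined

end SpectralGraph

open SpectralGraph

theorem theorem3p1 {V : Type u} [Fintype V] (T : SimpleGraph V) (hTree : T.IsTree)
    (hDLS : SpectralGraph.IsDLS T) (r : ℕ) (hr : 0 < r) :
    SpectralGraph.IsDLS
        (T.sum (SpectralGraph.copies r (SimpleGraph.completeGraph (Fin 2)))) ∧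
      (Odd (Fintype.card V) → r = 1 →
        SpectralGraph.IsDQS
          (T.sum (SpectralGraph.copies r (SimpleGraph.completeGraph (Fin 2))))) := by
  constructor
  · intro W _ H hH
    rw [lapSpectrum_eq, lapSpectrum_eq] at hH
    have h := lapPoly_eq_of_roots_eq hH
    rw [lapPoly_sum_copies, lapPoly_completeGraph_two] at h
    exact nonempty_iso_of_lapPoly_eq hTree hDLS h
  · rintro hodd rfl W _ H hH
    rw [signlessLapSpectrum_eq, signlessLapSpectrum_eq] at hH
    have h := lapPoly_eq_of_roots_eq hH
    have h2 : (SimpleGraph.completeGraph (Fin 2)).Colorable 2 := ⟨SimpleGraph.selfColoring _⟩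
    rw [lapPoly_sum_copies, lapPoly_one_eq_of_colorable hTree.colorable_two,
      lapPoly_one_eq_of_colorable h2, lapPoly_completeGraph_two] at h
    have htree := components_isTree_of_lapPoly_one_eq hTree
      (by rwa [Nat.card_eq_fintype_card]) h
    -- All components are trees, hence bipartite, so the Laplacian polynomial of `H` equals its
    -- signless one.
    refine nonempty_iso_of_lapPoly_eq hTree hDLS ?_
    have := Fintype.ofFinite H.ConnectedComponent
    rw [← h, lapPoly_eq_prod_components, lapPoly_eq_prod_components]
    exact Finset.prod_congr rfl fun c _ =>
      (lapPoly_one_eq_of_colorable (htree c).colorable_two).symm
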